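/- Let $J$ be the canonical symplectic matrix on $\mathbb{R}^{2d}$ and let $\rho\colon[0,1]\to\mathbb{R}$ be smooth on $[0,1]$ and of Gevrey class $2$ on $(0,1)$, i.e. there are constants $C,\beta>0$ with $\sup_{x\in(0,1)}|\rho^{(k)}(x)|\le C\,k!^2/\beta^k$ for all $k\ge 0$. Suppose $\rho(0)=0$, $\rho(1)=1$ and $\rho^{(i)}(0)=\rho^{(i)}(1)=0$ for all $i\ge1$. Let $a>0$, $R>0$, $z_0\in\mathbb{R}^{2d}$, write $B_r(z_0)$ for the closed ball of radius $r$, and let $V$ be a real-valued potential that is real analytic on $B_R(z_0)$. Define $$g_0=-J\nabla V,\qquad g_k=-J\sum_{i+j=k-1}\mathrm{D}g_i\,g_j\quad(k\ge1),\qquad G_n(q)=\varepsilon\sum_{i=0}^n\varepsilon^i g_i(q).$$ Then there exist $n(\varepsilon)\in\mathbb{N}$ for each $\varepsilon$, and constants $c,D>0$ independent of $\varepsilon$, all depending only on $\rho$, $a$ and on $V$ and the ball $B_R(z_0)$, such that the following holds. Let $\mathcal{K}\subset B_{R/2}(z_0)$ be compact, let $0<\varepsilon\le1$, $T=a/\varepsilon$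 and $q^*\in\mathbb{R}^{2d}$, and let $(q,p)$ be any solution on $[0,T]$ of the boundary value problem $$\dot q=p,\qquad \dot p=Jp-\varepsilon\,\rho(t/T)\,\nabla V(q),\qquad p(0)=0,\quad q(T)=q^*,$$ with $q(t)\in\mathcal{K}$ for all $t\in[0,T]$. Then $$\|p(T)-G_{n(\varepsilon)}(q^*)\|\le D\,\mathrm{e}^{-c\,\varepsilon^{-1/3}}.$$ -/

import Mathlib

open scoped ContDiff

noncomputable section

namespace OptimalBalance

/-- The position space `ℝ^{2d}` with its Euclidean norm. -/
abbrev Pos (d : ℕ) : Type := EuclideanSpace ℝ (Fin d ⊕ Fin d)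

/-- The canonical symplectic matrix of size `2d × 2d`, acting on `ℝ^{2d}`. -/
def J (d : ℕ) : Pos d →L[ℝ] Pos d :=
  Matrix.toEuclideanCLM (𝕜 := ℝ) (Matrix.J (Fin d) ℝ)

/-- `f` is of Gevrey class `s` on the open set `U ⊆ ℝ`. -/
def IsGevrey (s : ℝ) (f : ℝ → ℝ) (U : Set ℝ) : Prop :=
  ContDiffOn ℝ ∞ f U ∧
    ∃ C β : ℝ, 0 < C ∧ 0 < β ∧
      ∀ n : ℕ, ∀ x ∈ U, |iteratedDeriv n f x| ≤ C * (n.factorial : ℝ) ^ s / β ^ n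

/-- The coefficients of the slow vector field: `g₀ = -J ∇V` and
`g_{k+1} = -J ∑_{i+j=k} Dg_i g_j`. -/
def slowCoeff {d : ℕ} (V : Pos d → ℝ) : ℕ → Pos d → Pos d
  | 0 => fun q => -J d (gradient V q)
  | k + 1 => fun q =>
      -J d (∑ i : Fin (k + 1),
        fderiv ℝ (slowCoeff V i.val) q (slowCoeff V (k - i.val) q))
  termination_by k => k
  decreasing_by all_goals omega

theorem slowCoeff_zero {d : ℕ} (V : Pos d → ℝ) (q : Pos d) :
    slowCoeff V 0 q = -J d (gradient V q) := by
  rw [slowCoeff]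

theorem slowCoeff_succ {d : ℕ} (V : Pos d → ℝ) (k : ℕ) (q : Pos d) :
    slowCoeff V (k + 1) q =
      -J d (∑ ij ∈ Finset.HasAntidiagonal.antidiagonal k,
        fderiv ℝ (slowCoeff V ij.1) q (slowCoeff V ij.2 q)) := by
  rw [slowCoeff, Finset.Nat.sum_antidiagonal_eq_sum_range_succ_mk, Finset.sum_range]

/-- The slow vector field of order `n`: `G_n(q) = ε ∑_{i=0}^n ε^i g_i(q)`. -/
def slowField {d : ℕ} (V : Pos d → ℝ) (ε : ℝ) (n : ℕ) (q : Pos d) : Pos d :=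
  ε • ∑ i ∈ Finset.range (n + 1), ε ^ i • slowCoeff V i q

/-- `(q, p)` solves, on `[0, T]`, the boundary value problem
`q' = p`, `p' = J p - ε ρ(t/T) ∇V(q)`, `p(0) = 0`, `q(T) = q*`. -/
structure IsRampSolution {d : ℕ} (V : Pos d → ℝ) (ρ : ℝ → ℝ) (ε T : ℝ) (qstar : Pos d)
    (q p : ℝ → Pos d) : Prop where
  deriv_q : ∀ t ∈ Set.Icc (0 : ℝ) T, HasDerivWithinAt q (p t) (Set.Icc 0 T) t
  deriv_p : ∀ t ∈ Set.Icc (0 : ℝ) T,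
    HasDerivWithinAt p (J d (p t) - (ε * ρ (t / T)) • gradient V (q t)) (Set.Icc 0 T) t
  initial : p 0 = 0
  final : q T = qstar

end OptimalBalance

end

namespace OptimalBalance

open Set Filter Topology

/-! ### Flat extension of a ramp function to the real line -/

/-! Treat slow time τ = t/T as an extra state with velocity εb, b = 1/a, and look for an invariant
graph p = S(q, τ). Formally S = ε Σ ε^k g_k(q, τ), where the g_k (`jointCoeff`) solve the invariance
equation order by order. Flatness lets the ramp be extended smoothly by 0 and 1. The forcing then
vanishes for τ < 0 and is autonomous for τ > 1, so by continuity the truncated S is 0 at τ = 0 and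
G_n at τ = 1 (`jointCoeff_eq_of_eq_on_closure`). The solution thus starts on the graph, and it
remains to bound its drift.

The bounds on the g_k grow factorially, but in a controlled way: m-th derivatives are at most A B^m
M^k (m+k)!^3 (`norm_iteratedFDerivWithin_jointCoeff_le`), an induction closed by the convolution
estimate `sum_choose_mul_factorial_cube_le`. Truncating at n of order ε^(-1/3) leaves a defect of
order ε² e^(-n) (`norm_residual_le`).

The deviation w = p - S obeys w' = Jw - (D_q S)w - r with r this defect. The skew J does not change
‖w‖, and D_q S = O(ε) produces only bounded growth over time a/ε
(`norm_sq_le_of_hasDerivWithinAt_skew`), so w(T) is exponentially small. -/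

theorem hasDerivAt_of_const_outside {f f' : ℝ → ℝ} {c₀ c₁ : ℝ}
    (h₀ : ∀ x ≤ 0, f x = c₀) (h₁ : ∀ x, 1 ≤ x → f x = c₁)
    (h₀' : ∀ x ≤ 0, f' x = 0) (h₁' : ∀ x, 1 ≤ x → f' x = 0)
    (h : ∀ x ∈ Icc (0 : ℝ) 1, HasDerivWithinAt f (f' x) (Icc 0 1) x) (x : ℝ) :
    HasDerivAt f (f' x) x := by
  -- Three closed pieces cover the line. Relative to a piece whose closure misses `x`, any value is
  -- a derivative, so all three can be given `f' x` and united.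
  have hl : HasDerivWithinAt f (f' x) (Iic 0) x := by
    rcases le_or_gt x 0 with hx | hx
    · rw [h₀' x hx]
      exact (hasDerivWithinAt_const x _ c₀).congr (fun y hy => h₀ y hy) (h₀ x hx)
    · exact HasFDerivWithinAt.of_notMem_closure (by simpa using hx)
  have hr : HasDerivWithinAt f (f' x) (Ici 1) x := by
    rcases le_or_gt 1 x with hx | hx
    · rw [h₁' x hx]
      exact (hasDerivWithinAt_const x _ c₁).congr (fun y hy => h₁ y hy) (h₁ x hx)
    · exact HasFDerivWithinAt.of_notMem_closure (by simpa using hx)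
  have hm : HasDerivWithinAt f (f' x) (Icc 0 1) x := by
    by_cases hx : x ∈ Icc (0 : ℝ) 1
    · exact h x hx
    · exact HasFDerivWithinAt.of_notMem_closure (by rwa [isClosed_Icc.closure_eq])
  have hu := (hl.union hm).union hr
  rw [Iic_union_Icc_eq_Iic zero_le_one, Iic_union_Ici] at hu
  exact hasDerivWithinAt_univ.1 hu

/-- The iterated derivatives of the extension of `ρ` by `0` on the left of `[0, 1]` and by `1` on
its right. -/
noncomputable def rampJet (ρ : ℝ → ℝ) (k : ℕ) (x : ℝ) : ℝ :=
  (Icc (0 : ℝ) 1).indicator (iteratedDerivWithin k ρ (Icc 0 1)) x +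
    if k = 0 ∧ 1 < x then 1 else 0

theorem rampJet_of_mem {ρ : ℝ → ℝ} (k : ℕ) {x : ℝ} (hx : x ∈ Icc (0 : ℝ) 1) :
    rampJet ρ k x = iteratedDerivWithin k ρ (Icc 0 1) x := by
  simp [rampJet, indicator_of_mem hx, hx.2.not_gt]

theorem rampJet_of_nonpos {ρ : ℝ → ℝ} (hρ_zero : ρ 0 = 0)
    (hρ : ∀ i : ℕ, 1 ≤ i → iteratedDerivWithin i ρ (Icc 0 1) 0 = 0) (k : ℕ) {x : ℝ}
    (hx : x ≤ 0) : rampJet ρ k x = 0 := by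
  rcases hx.eq_or_lt with rfl | hx
  · rw [rampJet_of_mem k (by simp)]
    rcases Nat.eq_zero_or_pos k with rfl | hk
    · simpa using hρ_zero
    · exact hρ k hk
  · have : x ∉ Icc (0 : ℝ) 1 := fun h => hx.not_ge h.1
    have h1 : ¬ 1 < x := by linarith
    simp [rampJet, indicator_of_notMem this, h1]

theorem rampJet_of_one_le {ρ : ℝ → ℝ} (hρ_one : ρ 1 = 1)
    (hρ : ∀ i : ℕ, 1 ≤ i → iteratedDerivWithin i ρ (Icc 0 1) 1 = 0) (k : ℕ) {x : ℝ}
    (hx : 1 ≤ x) : rampJet ρ k x = if k = 0 then 1 else 0 := by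
  rcases hx.eq_or_lt with rfl | hx
  · rw [rampJet_of_mem k (by simp)]
    rcases Nat.eq_zero_or_pos k with rfl | hk
    · simpa using hρ_one
    · rw [hρ k hk, if_neg hk.ne']
  · have : x ∉ Icc (0 : ℝ) 1 := fun h => hx.not_ge h.2
    simp [rampJet, hx]

/-- A ramp that is flat at both ends of `[0, 1]` and of Gevrey class `2` on `(0, 1)` extends to a
function on `ℝ`, locally constant outside `[0, 1]`, with global Gevrey bounds. -/
theorem exists_flat_extension {ρ : ℝ → ℝ}
    (hρ_smooth : ContDiffOn ℝ ∞ ρ (Icc 0 1)) (hρ_gevrey : IsGevrey 2 ρ (Ioo 0 1))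
    (hρ_zero : ρ 0 = 0) (hρ_one : ρ 1 = 1)
    (hρ_order : ∀ i : ℕ, 1 ≤ i → iteratedDerivWithin i ρ (Icc 0 1) 0 = 0 ∧
      iteratedDerivWithin i ρ (Icc 0 1) 1 = 0) :
    ∃ σ : ℝ → ℝ, ContDiff ℝ ∞ σ ∧ (∀ x ∈ Icc (0 : ℝ) 1, σ x = ρ x) ∧ (∀ x ≤ 0, σ x = 0) ∧
      (∀ x, 1 ≤ x → σ x = 1) ∧ ∃ A B : ℝ, 0 < A ∧ 0 < B ∧
        ∀ (n : ℕ) (x : ℝ), ‖iteratedFDeriv ℝ n σ x‖ ≤ A * B ^ n * (n.factorial : ℝ) ^ 2 := by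
  have hl := fun k {x} => rampJet_of_nonpos (x := x) hρ_zero (fun i hi => (hρ_order i hi).1) k
  have hr := fun k {x} => rampJet_of_one_le (x := x) hρ_one (fun i hi => (hρ_order i hi).2) k
  have hder : ∀ k x, HasDerivAt (rampJet ρ k) (rampJet ρ (k + 1) x) x := by
    intro k
    refine hasDerivAt_of_const_outside (fun x hx => hl k hx) (fun x hx => hr k hx)
      (fun x hx => hl _ hx) (fun x hx => by simpa using hr (k + 1) hx) fun x hx => ?_
    have hd : DifferentiableWithinAt ℝ (iteratedDerivWithin k ρ (Icc 0 1)) (Icc 0 1) x :=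
      hρ_smooth.differentiableOn_iteratedDerivWithin
        (by exact_mod_cast WithTop.coe_lt_coe.2 (ENat.natCast_lt_top k))
        (uniqueDiffOn_Icc zero_lt_one) x hx
    rw [rampJet_of_mem _ hx, iteratedDerivWithin_succ]
    exact hd.hasDerivWithinAt.congr (fun y hy => rampJet_of_mem k hy) (rampJet_of_mem k hx)
  have hjet : ∀ k, iteratedDeriv k (rampJet ρ 0) = rampJet ρ k := by
    intro k
    induction k with
    | zero => simp
    | succ k ih => rw [iteratedDeriv_succ, ih]; exact funext fun x => (hder k x).deriv
  obtain ⟨-, C, β, hC, hβ, hb⟩ := hρ_gevrey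
  -- `C + 1` instead of `C` also covers the value 1 taken at order zero to the right of the ramp.
  refine ⟨rampJet ρ 0, ?_, fun x hx => by simp [rampJet_of_mem 0 hx], fun x hx => hl 0 hx,
    fun x hx => by simpa using hr 0 hx, C + 1, β⁻¹, by positivity, by positivity, fun n x => ?_⟩
  · exact contDiff_of_differentiable_iteratedDeriv (n := ⊤) fun m _ => by
      rw [hjet]; exact fun x => (hder m x).differentiableAt
  · rw [norm_iteratedFDeriv_eq_norm_iteratedDeriv, hjet]
    rcases le_or_gt x 0 with h0 | h0
    · rw [hl n h0, norm_zero]; positivity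
    rcases le_or_gt 1 x with h1 | h1
    · rw [hr n h1]
      split_ifs with hn
      · subst hn; simp [hC.le]
      · rw [norm_zero]; positivity
    · have hx : x ∈ Ioo (0 : ℝ) 1 := ⟨h0, h1⟩
      have hnhds : Icc (0 : ℝ) 1 ∈ 𝓝 x := Icc_mem_nhds h0 h1
      have h2 := hb n x hx
      rw [Real.rpow_two] at h2
      rw [rampJet_of_mem n (Ioo_subset_Icc_self hx), iteratedDerivWithin,
        iteratedFDerivWithin_congr_set (t := univ) (by simpa using hnhds),
        iteratedFDerivWithin_univ, ← iteratedDeriv, Real.norm_eq_abs]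
      refine h2.trans ?_
      rw [div_eq_mul_inv, ← inv_pow, mul_right_comm]
      gcongr
      linarith

/-! ### Uniform derivative bounds for analytic functions -/

variable {E F : Type*} [NormedAddCommGroup E] [NormedSpace ℝ E] [NormedAddCommGroup F]
  [NormedSpace ℝ F]

/-- The n-th derivative at the centre is the sum of `p n` over all n! permutations of its arguments.
-/
theorem norm_iteratedFDeriv_le_of_hasFPowerSeriesOnBall [CompleteSpace F] {f : E → F}
    {p : FormalMultilinearSeries ℝ E F} {x : E} {r : ENNReal} (h : HasFPowerSeriesOnBall f p x r)
    (n : ℕ) : ‖iteratedFDeriv ℝ n f x‖ ≤ n.factorial * ‖p n‖ := by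
  refine ContinuousMultilinearMap.opNorm_le_bound (by positivity) fun v => ?_
  rw [h.iteratedFDeriv_eq_sum_of_completeSpace]
  calc ‖∑ σ : Equiv.Perm (Fin n), p n (fun i => v (σ i))‖
      ≤ ∑ _σ : Equiv.Perm (Fin n), ‖p n‖ * ∏ i, ‖v i‖ := by
        refine norm_sum_le_of_le _ fun σ _ => ?_
        rw [← Equiv.prod_comp σ (fun i => ‖v i‖)]
        exact (p n).le_opNorm _
    _ = n.factorial * ‖p n‖ * ∏ i, ‖v i‖ := by
        simp [Fintype.card_perm, mul_assoc]

/-- All re-expanded coefficients, weighted by powers of `r`, are dominated by one family that is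
summable because 2r is below the radius. The n-th coefficient only involves one fibre of it, so the
total sum serves for every `n` and `y`. -/
theorem exists_norm_changeOrigin_le (p : FormalMultilinearSeries ℝ E F) {r : NNReal} (hr : 0 < r)
    (h : (r + r : ENNReal) < p.radius) :
    ∃ S : ℝ, 0 ≤ S ∧ ∀ y : E, ‖y‖ ≤ r → ∀ n, ‖p.changeOrigin y n‖ ≤ S * (r⁻¹ : ℝ) ^ n := by
  have hs := p.changeOriginSeries_summable_aux₁ h
  set g : (Σ k l : ℕ, { s : Finset (Fin (k + l)) // s.card = l }) → NNReal :=
    fun s => ‖p (s.1 + s.2.1)‖₊ * r ^ s.2.1 * r ^ s.1 with hg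
  refine ⟨(∑' s, g s : NNReal), NNReal.coe_nonneg _, fun y hy n => ?_⟩
  have hyr : ‖y‖₊ ≤ r := hy
  have hrp : (r : ENNReal) < p.radius := lt_of_le_of_lt le_self_add h
  have hyp : (‖y‖₊ : ENNReal) < p.radius :=
    lt_of_le_of_lt (by exact_mod_cast hyr) hrp
  have h1 := p.nnnorm_changeOrigin_le n hyp
  have h2 : (∑' s : Σ l : ℕ, { s : Finset (Fin (n + l)) // s.card = l },
      ‖p (n + s.1)‖₊ * ‖y‖₊ ^ s.1) ≤
      ∑' s : Σ l : ℕ, { s : Finset (Fin (n + l)) // s.card = l }, ‖p (n + s.1)‖₊ * r ^ s.1 :=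
    (p.changeOriginSeries_summable_aux₂ hyp n).tsum_le_tsum (fun s => by gcongr)
      (p.changeOriginSeries_summable_aux₂ hrp n)
  have h3 : (∑' s : Σ l : ℕ, { s : Finset (Fin (n + l)) // s.card = l },
      ‖p (n + s.1)‖₊ * r ^ s.1) * r ^ n ≤ ∑' s, g s := by
    rw [← NNReal.tsum_mul_right]
    have h5 := NNReal.tsum_comp_le_tsum_of_inj (f := g) hs (sigma_mk_injective (i := n))
    simpa only [Function.comp_def, hg] using h5
  have h4 : ‖p.changeOrigin y n‖₊ ≤ (∑' s, g s) * (r⁻¹) ^ n := by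
    rw [inv_pow, ← div_eq_mul_inv, le_div_iff₀ (by positivity)]
    exact (mul_le_mul_left (h1.trans h2) _).trans h3
  exact_mod_cast h4

theorem AnalyticAt.exists_eventually_norm_iteratedFDeriv_le [CompleteSpace F] {f : E → F} {x : E}
    (hf : AnalyticAt ℝ f x) : ∃ A B : ℝ, 0 < A ∧ 0 < B ∧
      ∀ᶠ y in 𝓝 x, ∀ n : ℕ, ‖iteratedFDeriv ℝ n f y‖ ≤ A * B ^ n * n.factorial := by
  obtain ⟨p, R, hp⟩ := hf
  obtain ⟨r, hr0, hr⟩ : ∃ r : NNReal, 0 < r ∧ (r + r : ENNReal) < R := by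
    obtain ⟨r, hr0, hr⟩ := ENNReal.lt_iff_exists_nnreal_btwn.1 hp.r_pos
    refine ⟨r / 2, by have : 0 < r := by exact_mod_cast hr0
                      positivity, ?_⟩
    rw [← ENNReal.coe_add, add_halves]
    exact hr
  obtain ⟨S, hS, hb⟩ := exists_norm_changeOrigin_le p hr0 (hr.trans_le hp.r_le)
  refine ⟨S + 1, (r⁻¹ : ℝ), by positivity, by positivity, ?_⟩
  filter_upwards [Metric.ball_mem_nhds x (show (0 : ℝ) < r from hr0)] with y hy n
  have hy' : ‖y - x‖ ≤ r := by
    rw [← dist_eq_norm]; exact (Metric.mem_ball.1 hy).le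
  have hyR : (‖y - x‖₊ : ENNReal) < R :=
    lt_of_le_of_lt (by exact_mod_cast hy') (lt_of_le_of_lt le_self_add hr)
  have h1 := norm_iteratedFDeriv_le_of_hasFPowerSeriesOnBall (hp.changeOrigin hyR) n
  rw [add_sub_cancel] at h1
  calc _ ≤ _ := h1
    _ ≤ n.factorial * (S * (r⁻¹ : ℝ) ^ n) := by gcongr; exact hb _ hy' n
    _ ≤ _ := by
      rw [mul_comm]; gcongr; linarith

theorem exists_norm_iteratedFDeriv_le_of_isCompact [CompleteSpace F] {f : E → F} {K : Set E}
    (hK : IsCompact K) (hf : AnalyticOnNhd ℝ f K) : ∃ A B : ℝ, 0 < A ∧ 0 < B ∧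
      ∀ y ∈ K, ∀ n : ℕ, ‖iteratedFDeriv ℝ n f y‖ ≤ A * B ^ n * n.factorial := by
  refine hK.induction_on (p := fun s => ∃ A B : ℝ, 0 < A ∧ 0 < B ∧
      ∀ y ∈ s, ∀ n : ℕ, ‖iteratedFDeriv ℝ n f y‖ ≤ A * B ^ n * n.factorial)
    ⟨1, 1, one_pos, one_pos, by simp⟩ ?_ ?_ ?_
  · rintro s t hst ⟨A, B, hA, hB, h⟩
    exact ⟨A, B, hA, hB, fun y hy => h y (hst hy)⟩
  · rintro s t ⟨A, B, hA, hB, h⟩ ⟨A', B', hA', hB', h'⟩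
    refine ⟨A + A', B + B', by positivity, by positivity, ?_⟩
    rintro y (hy | hy) n
    · refine (h y hy n).trans ?_
      gcongr <;> linarith
    · refine (h' y hy n).trans ?_
      gcongr <;> linarith
  · intro x hx
    obtain ⟨A, B, hA, hB, h⟩ := AnalyticAt.exists_eventually_norm_iteratedFDeriv_le (hf x hx)
    exact ⟨_, mem_nhdsWithin_of_mem_nhds h, A, B, hA, hB, fun y hy => hy⟩

end OptimalBalance

namespace OptimalBalance

open Set Filter Topology Finset

/-! ### A factorial convolution estimate -/

theorem choose_le_choose_add_add {m l i k : ℕ} (hik : i ≤ k) :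
    m.choose l ≤ (m + k + 1).choose (l + 1 + i) := by
  have h : ∀ i, m.choose l ≤ (m + i).choose (l + i) := by
    intro i
    induction i with
    | zero => simp
    | succ i ih =>
      refine ih.trans ?_
      rw [← add_assoc, ← add_assoc, Nat.choose_succ_succ]
      exact Nat.le_add_right _ _
  refine (h (i + 1)).trans ?_
  rw [show l + (i + 1) = l + 1 + i by ring]
  exact Nat.choose_le_choose _ (by omega)

theorem factorial_mul_factorial_succ_le {u : ℕ} (hu : 1 ≤ u) (v : ℕ) :
    u.factorial * (v + 1).factorial ≤ (u + v).factorial := by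
  induction v with
  | zero => simp
  | succ v ih =>
    rw [Nat.factorial_succ (v + 1), ← add_assoc, Nat.factorial_succ (u + v)]
    calc u.factorial * ((v + 1 + 1) * (v + 1).factorial)
        = (v + 1 + 1) * (u.factorial * (v + 1).factorial) := by ring
      _ ≤ _ := Nat.mul_le_mul (by omega) ih

theorem add_mul_factorial_mul_factorial_le {u v : ℕ} (hu : 1 ≤ u) (hv : 1 ≤ v) :
    (u + v) * (u.factorial * v.factorial) ≤ (u + v).factorial := by
  obtain ⟨v, rfl⟩ := Nat.exists_eq_add_of_le' hv
  rw [← add_assoc, Nat.factorial_succ (u + v)]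
  exact Nat.mul_le_mul le_rfl (factorial_mul_factorial_succ_le hu v)

/-- With u + v = N, one power of u! v! absorbs the binomial. If v ≥ 1, the two remaining powers each
gain a factor 1/N from N u! v! ≤ N!. The case v = 0 is the single exceptional term j = 0, l = m. -/
theorem choose_mul_factorial_cube_le {m l i j k : ℕ} (hl : l ≤ m) (hij : i + j = k) :
    (m.choose l : ℝ) * ((l + 1 + i).factorial : ℝ) ^ 3 * ((m - l + j).factorial : ℝ) ^ 3 ≤
      ((m + k + 1).factorial : ℝ) ^ 3 * ((if j = 0 then 1 else 0) * if l = m then 1 else 0) +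
        ((m + k + 1).factorial : ℝ) ^ 3 / ((m + k + 1 : ℕ) : ℝ) ^ 2 := by
  set N := m + k + 1 with hN
  set u := l + 1 + i with hu
  set v := m - l + j with hv
  have huv : u + v = N := by omega
  have h1 : m.choose l * (u.factorial * v.factorial) ≤ N.factorial := by
    rw [← huv, add_comm u v, ← Nat.add_choose_mul_factorial_mul_factorial v u, add_comm v u, huv,
      mul_assoc, mul_comm v.factorial]
    exact Nat.mul_le_mul (choose_le_choose_add_add (by omega)) le_rfl
  have h1' : (m.choose l : ℝ) * (u.factorial * v.factorial) ≤ N.factorial := by exact_mod_cast h1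
  have hNpos : (0 : ℝ) < (N : ℕ) := by positivity
  have key : (m.choose l : ℝ) * (u.factorial : ℝ) ^ 3 * (v.factorial : ℝ) ^ 3 ≤
      N.factorial * ((u.factorial : ℝ) * v.factorial) ^ 2 := by
    calc _ = ((m.choose l : ℝ) * (u.factorial * v.factorial)) *
          ((u.factorial : ℝ) * v.factorial) ^ 2 := by ring
      _ ≤ _ := by gcongr
  by_cases hv0 : v = 0
  · have hj : j = 0 := by omega
    have hlm : l = m := by omega
    have huN : u = N := by omega
    rw [if_pos hj, if_pos hlm]
    refine key.trans ?_
    rw [hv0, huN]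
    have : (0 : ℝ) ≤ (N.factorial : ℝ) ^ 3 / ((N : ℕ) : ℝ) ^ 2 := by positivity
    simp only [Nat.factorial_zero, Nat.cast_one, mul_one]
    nlinarith
  · have h2 := add_mul_factorial_mul_factorial_le (u := u) (v := v) (by omega) (by omega)
    rw [huv] at h2
    have h2' : (N : ℝ) * (u.factorial * v.factorial) ≤ N.factorial := by exact_mod_cast h2
    have h3 : (N.factorial : ℝ) * ((u.factorial : ℝ) * v.factorial) ^ 2 ≤
        (N.factorial : ℝ) ^ 3 / ((N : ℕ) : ℝ) ^ 2 := by
      rw [le_div_iff₀ (by positivity)]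
      calc _ = (N.factorial : ℝ) * ((N : ℝ) * (u.factorial * v.factorial)) ^ 2 := by ring
        _ ≤ (N.factorial : ℝ) * (N.factorial : ℝ) ^ 2 := by gcongr
        _ = _ := by ring
    refine (key.trans h3).trans (le_add_of_nonneg_left ?_)
    split_ifs <;> simp

/-- There are (k+1)(m+1) ≤ (m+k+1)² terms, which the gain 1/N² compensates; the exceptional term
contributes the other copy. The constant 2 is independent of m and k, as the induction on orders
requires. -/
theorem sum_choose_mul_factorial_cube_le (m k : ℕ) :
    ∑ ij ∈ antidiagonal k, ∑ l ∈ range (m + 1), (m.choose l : ℝ) *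
      ((l + 1 + ij.1).factorial : ℝ) ^ 3 * ((m - l + ij.2).factorial : ℝ) ^ 3 ≤
      2 * ((m + k + 1).factorial : ℝ) ^ 3 := by
  set X : ℝ := ((m + k + 1).factorial : ℝ) ^ 3 with hX
  have hX0 : 0 ≤ X := by positivity
  calc _ ≤ ∑ ij ∈ antidiagonal k, ∑ l ∈ range (m + 1),
        (X * ((if ij.2 = 0 then 1 else 0) * if l = m then 1 else 0) +
          X / ((m + k + 1 : ℕ) : ℝ) ^ 2) := by
        refine Finset.sum_le_sum fun ij hij => Finset.sum_le_sum fun l hl => ?_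
        exact choose_mul_factorial_cube_le (Nat.lt_succ_iff.1 (Finset.mem_range.1 hl))
          (mem_antidiagonal.1 hij)
    _ = X + (k + 1) * (m + 1) * (X / ((m + k + 1 : ℕ) : ℝ) ^ 2) := by
        simp only [Finset.sum_add_distrib, ← Finset.mul_sum, Finset.sum_const, card_range,
          Nat.card_antidiagonal, nsmul_eq_mul, Finset.sum_ite_eq', Finset.mem_range]
        rw [Nat.sum_antidiagonal_eq_sum_range_succ_mk, Finset.sum_range_succ]
        rw [Finset.sum_eq_zero fun i hi => ?_]
        · simp; ring
        · have := Finset.mem_range.1 hi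
          simp; omega
    _ ≤ X + X := by
        gcongr
        rw [← mul_div_assoc, div_le_iff₀ (by positivity), mul_comm]
        gcongr
        push_cast
        nlinarith [mul_nonneg (Nat.cast_nonneg (α := ℝ) m) (Nat.cast_nonneg (α := ℝ) k),
          Nat.cast_nonneg (α := ℝ) m, Nat.cast_nonneg (α := ℝ) k]
    _ = 2 * X := by ring

/-! ### Coefficients of the formal slow manifold of a non-autonomous system -/

variable {E : Type*} [NormedAddCommGroup E] [NormedSpace ℝ E]

/-- The coefficients of the formal slow vector field of a non-autonomous system, as functions of
position and slow time; `b` is the velocity of slow time. -/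
noncomputable def jointCoeff (L : E →L[ℝ] E) (b : ℝ) (F : E × ℝ → E) : ℕ → E × ℝ → E
  | 0 => F
  | k + 1 => fun x =>
      L (∑ i : Fin (k + 1), fderiv ℝ (jointCoeff L b F i.val) x
        (jointCoeff L b F (k - i.val) x, if k - i.val = 0 then b else 0))
  termination_by k => k
  decreasing_by all_goals omega

/-- The coefficients `jointCoeff`, completed by the velocity of slow time. -/
noncomputable def extCoeff (L : E →L[ℝ] E) (b : ℝ) (F : E × ℝ → E) (k : ℕ) (x : E × ℝ) : E × ℝ :=
  (jointCoeff L b F k x, if k = 0 then b else 0)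

variable (L : E →L[ℝ] E) (b : ℝ) (F : E × ℝ → E)

theorem jointCoeff_zero : jointCoeff L b F 0 = F := by
  rw [jointCoeff]

theorem jointCoeff_succ (k : ℕ) (x : E × ℝ) :
    jointCoeff L b F (k + 1) x =
      L (∑ ij ∈ antidiagonal k,
        fderiv ℝ (jointCoeff L b F ij.1) x (extCoeff L b F ij.2 x)) := by
  rw [jointCoeff, Nat.sum_antidiagonal_eq_sum_range_succ_mk, Finset.sum_range]
  rfl

variable {L b F} {Ω : Set (E × ℝ)}

theorem contDiffOn_jointCoeff (hΩ : IsOpen Ω) (hF : ContDiffOn ℝ ∞ F Ω) (k : ℕ) :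
    ContDiffOn ℝ ∞ (jointCoeff L b F k) Ω := by
  induction k using Nat.strong_induction_on with
  | _ k ih =>
    rcases k with _ | k
    · rwa [jointCoeff_zero]
    · have h : jointCoeff L b F (k + 1) = fun x => L (∑ ij ∈ antidiagonal k,
          fderiv ℝ (jointCoeff L b F ij.1) x (extCoeff L b F ij.2 x)) :=
        funext fun x => jointCoeff_succ L b F k x
      rw [h]
      refine L.contDiff.comp_contDiffOn (ContDiffOn.sum fun ij hij => ?_)
      have hij' := mem_antidiagonal.1 hij
      have h1 := ih ij.1 (by omega)
      have h2 := ih ij.2 (by omega)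
      exact (h1.fderiv_of_isOpen hΩ le_rfl).clm_apply (h2.prodMk contDiffOn_const)

theorem contDiffOn_extCoeff (hΩ : IsOpen Ω) (hF : ContDiffOn ℝ ∞ F Ω) (k : ℕ) :
    ContDiffOn ℝ ∞ (extCoeff L b F k) Ω :=
  (contDiffOn_jointCoeff hΩ hF k).prodMk contDiffOn_const

/-- The time component is constant and nonzero only at order 0, so it matters only for m = k = 0. -/
theorem norm_iteratedFDerivWithin_extCoeff_le {A B M : ℝ} {k m : ℕ} (hA : 0 ≤ A) (hB : 0 ≤ B)
    (hM : 0 ≤ M) (hΩ : IsOpen Ω) (hF : ContDiffOn ℝ ∞ F Ω) {x : E × ℝ} (hx : x ∈ Ω)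
    (h : ‖iteratedFDerivWithin ℝ m (jointCoeff L b F k) Ω x‖ ≤
      A * B ^ m * M ^ k * ((m + k).factorial : ℝ) ^ 3) :
    ‖iteratedFDerivWithin ℝ m (extCoeff L b F k) Ω x‖ ≤
      (A + |b|) * B ^ m * M ^ k * ((m + k).factorial : ℝ) ^ 3 := by
  have h1 : extCoeff L b F k = fun x => (jointCoeff L b F k x, if k = 0 then b else 0) := rfl
  rw [h1, iteratedFDerivWithin_prodMk (n := ∞) ((contDiffOn_jointCoeff hΩ hF k) x hx)
    contDiffWithinAt_const hΩ.uniqueDiffOn hx (by exact_mod_cast le_top),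
    ContinuousMultilinearMap.opNorm_prod]
  refine max_le (h.trans ?_) ?_
  · gcongr
    exact le_add_of_nonneg_right (abs_nonneg b)
  · by_cases hm : m = 0
    · subst hm
      rw [norm_iteratedFDerivWithin_zero]
      by_cases hk : k = 0
      · subst hk; simp [hA]
      · rw [if_neg hk, norm_zero]; positivity
    · rw [iteratedFDerivWithin_const_of_ne hm]
      simp only [Pi.zero_apply, norm_zero]; positivity

/-- Gevrey-type bounds of class `3` for all coefficients of the formal slow manifold. -/
theorem norm_iteratedFDerivWithin_jointCoeff_le {A B : ℝ} (hA : 0 ≤ A) (hB : 0 ≤ B)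
    (hL : ‖L‖ ≤ 1) (hΩ : IsOpen Ω) (hF : ContDiffOn ℝ ∞ F Ω)
    (hb : ∀ m : ℕ, ∀ x ∈ Ω, ‖iteratedFDerivWithin ℝ m F Ω x‖ ≤ A * B ^ m * (m.factorial : ℝ) ^ 3)
    (k m : ℕ) {x : E × ℝ} (hx : x ∈ Ω) :
    ‖iteratedFDerivWithin ℝ m (jointCoeff L b F k) Ω x‖ ≤
      A * B ^ m * (2 * (A + |b|) * B) ^ k * ((m + k).factorial : ℝ) ^ 3 := by
  -- The rate that closes the induction: 2 from the convolution, `A + |b|` from the extended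
  -- coefficient, `B` from the extra derivative.
  set M : ℝ := 2 * (A + |b|) * B with hMdef
  have hM : 0 ≤ M := by positivity
  induction k using Nat.strong_induction_on generalizing m with
  | _ k ih =>
    rcases k with _ | k
    · rw [jointCoeff_zero]; simpa using hb m x hx
    have hm : (m : ℕ∞ω) ≤ ∞ := by exact_mod_cast le_top
    have hu := hΩ.uniqueDiffOn (𝕜 := ℝ)
    have hd : ∀ ij : ℕ × ℕ, ContDiffOn ℝ ∞ (fun x =>
        fderiv ℝ (jointCoeff L b F ij.1) x (extCoeff L b F ij.2 x)) Ω := fun ij =>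
      ((contDiffOn_jointCoeff hΩ hF ij.1).fderiv_of_isOpen hΩ le_rfl).clm_apply
        (contDiffOn_extCoeff hΩ hF ij.2)
    have heq : jointCoeff L b F (k + 1) = L ∘ fun x => ∑ ij ∈ antidiagonal k,
        fderiv ℝ (jointCoeff L b F ij.1) x (extCoeff L b F ij.2 x) :=
      funext fun x => jointCoeff_succ L b F k x
    have hterm : ∀ ij ∈ antidiagonal k, ‖iteratedFDerivWithin ℝ m (fun x =>
        fderiv ℝ (jointCoeff L b F ij.1) x (extCoeff L b F ij.2 x)) Ω x‖ ≤
        ∑ l ∈ range (m + 1), A * (A + |b|) * B ^ (m + 1) * M ^ k * ((m.choose l : ℝ) *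
          ((l + 1 + ij.1).factorial : ℝ) ^ 3 * ((m - l + ij.2).factorial : ℝ) ^ 3) := by
      rintro ⟨i, j⟩ hij
      have hij' : i + j = k := mem_antidiagonal.1 hij
      have hc : EqOn (fun x => fderiv ℝ (jointCoeff L b F i) x (extCoeff L b F j x))
          (fun x => fderivWithin ℝ (jointCoeff L b F i) Ω x (extCoeff L b F j x)) Ω :=
        fun y hy => by simp only [fderivWithin_of_isOpen hΩ hy]
      rw [iteratedFDerivWithin_congr hc hx]
      refine (norm_iteratedFDerivWithin_clm_apply (N := ∞)
        ((contDiffOn_jointCoeff hΩ hF i).fderivWithin hu le_rfl)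
        (contDiffOn_extCoeff hΩ hF j) hu hx hm).trans ?_
      refine Finset.sum_le_sum fun l hl => ?_
      have hl' : l ≤ m := Nat.lt_succ_iff.1 (Finset.mem_range.1 hl)
      have h1 := ih i (by omega) (l + 1)
      have h2 := norm_iteratedFDerivWithin_extCoeff_le hA hB hM hΩ hF hx (ih j (by omega) (m - l))
      rw [norm_iteratedFDerivWithin_fderivWithin hu hx]
      calc _ ≤ (m.choose l : ℝ) * (A * B ^ (l + 1) * M ^ i * ((l + 1 + i).factorial : ℝ) ^ 3) *
            ((A + |b|) * B ^ (m - l) * M ^ j * ((m - l + j).factorial : ℝ) ^ 3) := by gcongr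
        _ = _ := by
          rw [← hij', show m + 1 = (l + 1) + (m - l) by omega, pow_add B (l + 1), pow_add M]
          ring
    rw [heq]
    refine (L.norm_iteratedFDerivWithin_comp_left
      ((ContDiffOn.sum fun ij _ => hd ij) x hx) hu hx hm).trans ?_
    rw [iteratedFDerivWithin_fun_sum_apply hu hx fun ij _ => ((hd ij) x hx).of_le hm]
    calc _ ≤ 1 * ∑ ij ∈ antidiagonal k, ∑ l ∈ range (m + 1),
          A * (A + |b|) * B ^ (m + 1) * M ^ k * ((m.choose l : ℝ) *
          ((l + 1 + ij.1).factorial : ℝ) ^ 3 * ((m - l + ij.2).factorial : ℝ) ^ 3) := by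
          gcongr
          exact norm_sum_le_of_le _ hterm
      _ = A * (A + |b|) * B ^ (m + 1) * M ^ k * ∑ ij ∈ antidiagonal k, ∑ l ∈ range (m + 1),
          (m.choose l : ℝ) *
          ((l + 1 + ij.1).factorial : ℝ) ^ 3 * ((m - l + ij.2).factorial : ℝ) ^ 3 := by
          simp only [one_mul, Finset.mul_sum]
      _ ≤ A * (A + |b|) * B ^ (m + 1) * M ^ k * (2 * ((m + k + 1).factorial : ℝ) ^ 3) := by
          gcongr
          exact sum_choose_mul_factorial_cube_le m k
      _ = A * B ^ m * M ^ (k + 1) * ((m + (k + 1)).factorial : ℝ) ^ 3 := by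
          rw [pow_succ M k, ← add_assoc, hMdef]; ring

/-- Where the forcing does not depend on slow time, the coefficients are those of the autonomous
problem. -/
theorem jointCoeff_eq_of_eq_on {U : Set E} {I : Set ℝ} (hU : IsOpen U) (hI : IsOpen I)
    (hF : ContDiffOn ℝ ∞ F (U ×ˢ I)) {s : ℕ → E → E}
    (h0 : ∀ q ∈ U, ∀ t ∈ I, F (q, t) = s 0 q)
    (hs : ∀ k q, s (k + 1) q = L (∑ ij ∈ antidiagonal k, fderiv ℝ (s ij.1) q (s ij.2 q)))
    (k : ℕ) {q : E} (hq : q ∈ U) {t : ℝ} (ht : t ∈ I) : jointCoeff L b F k (q, t) = s k q := by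
  induction k using Nat.strong_induction_on generalizing q t with
  | _ k ih =>
    rcases k with _ | k
    · rw [jointCoeff_zero]; exact h0 q hq t ht
    · rw [jointCoeff_succ, hs]
      congr 1
      refine Finset.sum_congr rfl fun ij hij => ?_
      have hij' := mem_antidiagonal.1 hij
      have hO : IsOpen (U ×ˢ I) := hU.prod hI
      have hmem : (q, t) ∈ U ×ˢ I := ⟨hq, ht⟩
      have h1 : jointCoeff L b F ij.1 =ᶠ[𝓝 (q, t)] s ij.1 ∘ Prod.fst := by
        filter_upwards [hO.mem_nhds hmem] with y hy
        exact ih ij.1 (by omega) hy.1 hy.2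
      -- Regularity of `s` is not assumed; it is inherited from the joint coefficient on the slice
      -- at time `t`.
      have h2 : DifferentiableAt ℝ (s ij.1) q := by
        have hd : DifferentiableAt ℝ (jointCoeff L b F ij.1) (q, t) :=
          ((contDiffOn_jointCoeff hO hF ij.1).contDiffAt (hO.mem_nhds hmem)).differentiableAt
            (by simp)
        have hc : DifferentiableAt ℝ (fun y => jointCoeff L b F ij.1 (y, t)) q :=
          DifferentiableAt.comp (f := fun y : E => (y, t)) q hd (by fun_prop)
        refine hc.congr_of_eventuallyEq ?_
        filter_upwards [hU.mem_nhds hq] with y hy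
        exact (ih ij.1 (by omega) hy ht).symm
      have h3 : fderiv ℝ (s ij.1 ∘ Prod.fst) (q, t) =
          (fderiv ℝ (s ij.1) q).comp (ContinuousLinearMap.fst ℝ E ℝ) :=
        (h2.hasFDerivAt.comp (q, t) hasFDerivAt_fst).fderiv
      rw [h1.fderiv_eq, h3]
      simp [extCoeff, ih ij.2 (by omega) hq ht]

/-- The ramp ends τ = 0 and τ = 1 are only boundary points of the regions of frozen forcing;
continuity in τ reaches them. -/
theorem jointCoeff_eq_of_eq_on_closure {U : Set E} {I : Set ℝ} (hU : IsOpen U) (hI : IsOpen I)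
    (hF : ContDiffOn ℝ ∞ F (U ×ˢ univ)) {s : ℕ → E → E}
    (h0 : ∀ q ∈ U, ∀ t ∈ I, F (q, t) = s 0 q)
    (hs : ∀ k q, s (k + 1) q = L (∑ ij ∈ antidiagonal k, fderiv ℝ (s ij.1) q (s ij.2 q)))
    (k : ℕ) {q : E} (hq : q ∈ U) {t : ℝ} (ht : t ∈ closure I) :
    jointCoeff L b F k (q, t) = s k q := by
  have hc : Continuous fun t : ℝ => jointCoeff L b F k (q, t) := by
    rw [← continuousOn_univ]
    exact (contDiffOn_jointCoeff (hU.prod isOpen_univ) hF k).continuousOn.comp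
      (by fun_prop) fun t _ => ⟨hq, mem_univ t⟩
  have hsub : I ⊆ {t | jointCoeff L b F k (q, t) = s k q} := fun t ht =>
    jointCoeff_eq_of_eq_on hU hI (hF.mono (prod_mono_right (subset_univ I))) h0 hs k hq ht
  exact closure_minimal hsub (isClosed_eq hc continuous_const) ht

/-! ### Bounds for products of Gevrey and analytic functions of separate variables -/

/-- In the Leibniz rule, i!² (m-i)! ≤ m!³, and the binomial theorem sums the rates. The crude
factorial bound fits the cubes of the convolution estimate. -/
theorem norm_iteratedFDerivWithin_smul_prod_le {U : Set E} (hU : IsOpen U) {σ : ℝ → ℝ}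
    {h : E → E} (hσ : ContDiff ℝ ∞ σ) (hh : ContDiffOn ℝ ∞ h U) {A B A' B' : ℝ}
    (hA : 0 ≤ A) (hB : 0 ≤ B) (hA' : 0 ≤ A') (hB' : 0 ≤ B')
    (bσ : ∀ (n : ℕ) (t : ℝ), ‖iteratedFDeriv ℝ n σ t‖ ≤ A * B ^ n * (n.factorial : ℝ) ^ 2)
    (bh : ∀ (n : ℕ), ∀ q ∈ U, ‖iteratedFDeriv ℝ n h q‖ ≤ A' * B' ^ n * n.factorial)
    (m : ℕ) {x : E × ℝ} (hx : x ∈ U ×ˢ (univ : Set ℝ)) :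
    ‖iteratedFDerivWithin ℝ m (fun y : E × ℝ => σ y.2 • h y.1) (U ×ˢ univ) x‖ ≤
      (A * A') * (B + B') ^ m * (m.factorial : ℝ) ^ 3 := by
  have hO : IsOpen (U ×ˢ (univ : Set ℝ)) := hU.prod isOpen_univ
  have hm : (m : ℕ∞ω) ≤ ∞ := by exact_mod_cast le_top
  have hu := hO.uniqueDiffOn (𝕜 := ℝ)
  have hs : ContDiffOn ℝ ∞ (fun y : E × ℝ => σ y.2) (U ×ˢ univ) :=
    (hσ.comp contDiff_snd).contDiffOn
  have hf : ContDiffOn ℝ ∞ (fun y : E × ℝ => h y.1) (U ×ˢ univ) :=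
    hh.comp contDiffOn_fst fun y hy => hy.1
  refine (norm_iteratedFDerivWithin_smul_le hs hf hu hx hm).trans ?_
  have h1 : ∀ n, ‖iteratedFDerivWithin ℝ n (fun y : E × ℝ => σ y.2) (U ×ˢ univ) x‖ ≤
      A * B ^ n * (n.factorial : ℝ) ^ 2 := by
    intro n
    rw [iteratedFDerivWithin_of_isOpen n hO hx]
    have := ContinuousLinearMap.iteratedFDeriv_comp_right (ContinuousLinearMap.snd ℝ E ℝ)
      hσ x (i := n) (by exact_mod_cast le_top)
    have e : (fun y : E × ℝ => σ y.2) = σ ∘ ContinuousLinearMap.snd ℝ E ℝ := rfl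
    rw [e, this]
    refine (ContinuousMultilinearMap.norm_compContinuousLinearMap_le _ _).trans ?_
    refine (mul_le_of_le_one_right (norm_nonneg _) ?_).trans (bσ n _)
    exact Finset.prod_le_one (fun _ _ => norm_nonneg _)
      fun _ _ => ContinuousLinearMap.norm_snd_le ..
  have h2 : ∀ n, ‖iteratedFDerivWithin ℝ n (fun y : E × ℝ => h y.1) (U ×ˢ univ) x‖ ≤
      A' * B' ^ n * n.factorial := by
    intro n
    have hpre : (ContinuousLinearMap.fst ℝ E ℝ) ⁻¹' U = U ×ˢ univ := by ext; simp
    have := ContinuousLinearMap.iteratedFDerivWithin_comp_right (ContinuousLinearMap.fst ℝ E ℝ)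
      hh hU.uniqueDiffOn (by rw [hpre]; exact hu) (x := x) hx.1 (i := n)
      (by exact_mod_cast le_top)
    rw [hpre] at this
    have e : (fun y : E × ℝ => h y.1) = h ∘ ContinuousLinearMap.fst ℝ E ℝ := rfl
    have hx1 : ContinuousLinearMap.fst ℝ E ℝ x ∈ U := hx.1
    rw [e, this, iteratedFDerivWithin_of_isOpen n hU hx1]
    refine (ContinuousMultilinearMap.norm_compContinuousLinearMap_le _ _).trans ?_
    refine (mul_le_of_le_one_right (norm_nonneg _) ?_).trans (bh n _ hx.1)
    exact Finset.prod_le_one (fun _ _ => norm_nonneg _)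
      fun _ _ => ContinuousLinearMap.norm_fst_le ..
  calc _ ≤ ∑ i ∈ range (m + 1), (A * A' * (m.factorial : ℝ) ^ 3) *
        (B ^ i * B' ^ (m - i) * m.choose i) := by
        refine Finset.sum_le_sum fun i hi => ?_
        have hi' : i ≤ m := Nat.lt_succ_iff.1 (Finset.mem_range.1 hi)
        have e1 : (i.factorial : ℝ) ≤ m.factorial := by exact_mod_cast Nat.factorial_le hi'
        have e2 : ((m - i).factorial : ℝ) ≤ m.factorial := by
          exact_mod_cast Nat.factorial_le (Nat.sub_le m i)
        calc _ ≤ (m.choose i : ℝ) * (A * B ^ i * (m.factorial : ℝ) ^ 2) *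
              (A' * B' ^ (m - i) * m.factorial) := by
              gcongr
              · exact (h1 i).trans (by gcongr)
              · exact (h2 _).trans (by gcongr)
          _ = _ := by ring
    _ = _ := by rw [← Finset.mul_sum, ← add_pow]; ring

end OptimalBalance

namespace OptimalBalance

open Set Filter Topology Finset

variable {E : Type*} [NormedAddCommGroup E] [NormedSpace ℝ E]

/-! ### The truncated slow manifold and its residual -/

/-- The formal slow vector field truncated at order `n`. -/
noncomputable def jointField (L : E →L[ℝ] E) (b : ℝ) (F : E × ℝ → E) (ε : ℝ) (n : ℕ)
    (x : E × ℝ) : E :=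
  ε • ∑ i ∈ range (n + 1), ε ^ i • jointCoeff L b F i x

variable {L J' : E →L[ℝ] E} {b : ℝ} {F : E × ℝ → E} {Ω : Set (E × ℝ)}

/-- Antidiagonals below `n` lie wholly in the square. They are the orders at which the invariance
equation holds exactly; the rest is the defect. -/
theorem sum_range_product_eq {G : Type*} [AddCommMonoid G] (n : ℕ) (f : ℕ × ℕ → G) :
    ∑ p ∈ range (n + 1) ×ˢ range (n + 1), f p =
      ∑ k ∈ range n, ∑ p ∈ antidiagonal k, f p +
        ∑ p ∈ range (n + 1) ×ˢ range (n + 1) with n ≤ p.1 + p.2, f p := by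
  rw [← Finset.sum_filter_add_sum_filter_not _ (fun p : ℕ × ℕ => p.1 + p.2 < n)]
  congr 1
  · rw [← Finset.sum_fiberwise_of_maps_to (t := range n) (g := fun p : ℕ × ℕ => p.1 + p.2)
      fun p hp => Finset.mem_range.2 (Finset.mem_filter.1 hp).2]
    refine Finset.sum_congr rfl fun k hk => Finset.sum_congr ?_ fun _ _ => rfl
    have := Finset.mem_range.1 hk
    ext p
    simp only [Finset.mem_filter, Finset.mem_product, Finset.mem_range,
      Finset.HasAntidiagonal.mem_antidiagonal]
    omega
  · simp only [not_lt]

theorem hasFDerivAt_jointField (hΩ : IsOpen Ω) (hF : ContDiffOn ℝ ∞ F Ω) (ε : ℝ) (n : ℕ)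
    {x : E × ℝ} (hx : x ∈ Ω) :
    HasFDerivAt (jointField L b F ε n)
      (ε • ∑ i ∈ range (n + 1), ε ^ i • fderiv ℝ (jointCoeff L b F i) x) x := by
  refine HasFDerivAt.const_smul (HasFDerivAt.fun_sum fun i _ => HasFDerivAt.const_smul ?_ _) _
  exact (((contDiffOn_jointCoeff hΩ hF i).contDiffAt (hΩ.mem_nhds hx)).differentiableAt
    (by simp)).hasFDerivAt

theorem jointField_extend (ε : ℝ) (n : ℕ) (x : E × ℝ) :
    (jointField L b F ε n x, ε * b) =
      ε • ∑ j ∈ range (n + 1), ε ^ j • extCoeff L b F j x := by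
  refine Prod.ext ?_ ?_
  · simp [jointField, extCoeff, Prod.fst_sum]
  · simp [extCoeff, Prod.snd_sum]

/-- The defect of the invariance equation of the truncated slow manifold. -/
theorem fderiv_jointField_residual (hΩ : IsOpen Ω) (hF : ContDiffOn ℝ ∞ F Ω)
    (hJL : ∀ v, J' (L v) = v) (ε : ℝ) (n : ℕ) {x : E × ℝ} (hx : x ∈ Ω) :
    fderiv ℝ (jointField L b F ε n) x (jointField L b F ε n x, ε * b) -
      (J' (jointField L b F ε n x) - ε • J' (F x)) =
      ∑ p ∈ range (n + 1) ×ˢ range (n + 1) with n ≤ p.1 + p.2,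
        ε ^ (p.1 + p.2 + 2) • fderiv ℝ (jointCoeff L b F p.1) x (extCoeff L b F p.2 x) := by
  set f : ℕ × ℕ → E := fun p =>
    ε ^ (p.1 + p.2 + 2) • fderiv ℝ (jointCoeff L b F p.1) x (extCoeff L b F p.2 x) with hf
  have h1 : fderiv ℝ (jointField L b F ε n) x (jointField L b F ε n x, ε * b) =
      ∑ p ∈ range (n + 1) ×ˢ range (n + 1), f p := by
    rw [(hasFDerivAt_jointField hΩ hF ε n hx).fderiv, jointField_extend, Finset.sum_product]
    simp only [smul_apply, _root_.sum_apply, map_smul, map_sum,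
      Finset.smul_sum, smul_smul, hf]
    rw [Finset.sum_comm]
    refine Finset.sum_congr rfl fun i _ => Finset.sum_congr rfl fun j _ => ?_
    congr 1
    ring
  -- `J'` undoes the `L` of the recursion, leaving the antidiagonal sums; the forcing cancels order
  -- zero.
  have h2 : J' (jointField L b F ε n x) - ε • J' (F x) =
      ∑ k ∈ range n, ∑ p ∈ antidiagonal k, f p := by
    rw [jointField, Finset.sum_range_succ', jointCoeff_zero]
    simp only [map_smul, map_add, map_sum, jointCoeff_succ, hJL, pow_zero, one_smul, smul_add,
      add_sub_cancel_right, Finset.smul_sum, smul_smul]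
    refine Finset.sum_congr rfl fun k _ => Finset.sum_congr rfl fun p hp => ?_
    rw [hf, ← Finset.HasAntidiagonal.mem_antidiagonal.1 hp]
    congr 1
    ring
  rw [h1, h2, sum_range_product_eq n f, add_sub_cancel_left]

/-! ### Geometric bounds below the truncation order -/

theorem factorial_succ_le_pow {i n : ℕ} (h : i ≤ n) : (i + 1).factorial ≤ (n + 1) ^ i := by
  induction i with
  | zero => simp
  | succ i ih =>
    rw [Nat.factorial_succ, pow_succ, mul_comm]
    exact Nat.mul_le_mul (ih (by omega)) (by omega)

/-- Up to order `n` the factorially growing bounds are dominated by a geometric sequence, of small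
ratio once n³ is small against 1/ε. -/
theorem mul_pow_factorial_succ_cube_le {ε M : ℝ} (hε : 0 ≤ ε) (hM : 0 ≤ M) {i n : ℕ} (h : i ≤ n) :
    ε ^ i * (M ^ i * ((i + 1).factorial : ℝ) ^ 3) ≤ (ε * M * (n + 1) ^ 3) ^ i := by
  have h1 : ((i + 1).factorial : ℝ) ≤ ((n : ℝ) + 1) ^ i := by
    exact_mod_cast factorial_succ_le_pow h
  calc _ ≤ ε ^ i * (M ^ i * (((n : ℝ) + 1) ^ i) ^ 3) := by gcongr
    _ = _ := by rw [mul_pow, mul_pow, ← pow_mul, ← pow_mul, mul_comm i 3]; ring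

theorem sum_pow_le_two {y : ℝ} {n : ℕ} (hy : 0 ≤ y) (h : n = 0 ∨ y ≤ Real.exp (-3)) :
    ∑ i ∈ range (n + 1), y ^ i ≤ 2 := by
  rcases h with rfl | h
  · simp
  · have h2 : Real.exp (-3) ≤ 1 / 2 := by
      rw [Real.exp_neg, inv_eq_one_div]
      gcongr
      linarith [Real.add_one_le_exp (3 : ℝ)]
    refine le_trans (Finset.sum_le_sum fun i _ => pow_le_pow_left₀ hy (h.trans h2) i) ?_
    exact sum_geometric_two_le _

/-- Of the decay e^(-3n), two factors e^n pay for the (n+1)² terms of the defect. The alternative n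
= 0 covers ε that is not small. -/
theorem sq_mul_pow_le_exp {y : ℝ} {n : ℕ} (hy : 0 ≤ y) (h : n = 0 ∨ y ≤ Real.exp (-3)) :
    ((n : ℝ) + 1) ^ 2 * y ^ n ≤ Real.exp (-n) := by
  rcases h with rfl | h
  · simp
  · calc ((n : ℝ) + 1) ^ 2 * y ^ n ≤ Real.exp n ^ 2 * Real.exp (-3) ^ n := by
          gcongr
          exact Real.add_one_le_exp _
      _ = Real.exp (-n) := by
          rw [← Real.exp_nat_mul, ← Real.exp_nat_mul, ← Real.exp_add]
          congr 1
          push_cast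
          ring

section Bounds

variable {A B : ℝ} (hA : 0 ≤ A) (hB : 0 ≤ B) (hL : ‖L‖ ≤ 1) (hΩ : IsOpen Ω)
  (hF : ContDiffOn ℝ ∞ F Ω)
  (hb : ∀ m : ℕ, ∀ x ∈ Ω, ‖iteratedFDerivWithin ℝ m F Ω x‖ ≤ A * B ^ m * (m.factorial : ℝ) ^ 3)

include hA hB hL hΩ hF hb

theorem norm_fderiv_jointCoeff_le (i : ℕ) {x : E × ℝ} (hx : x ∈ Ω) :
    ‖fderiv ℝ (jointCoeff L b F i) x‖ ≤
      A * B * ((2 * (A + |b|) * B) ^ i * ((i + 1).factorial : ℝ) ^ 3) := by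
  have h := norm_iteratedFDerivWithin_jointCoeff_le (b := b) hA hB hL hΩ hF hb i 1 hx
  rw [norm_iteratedFDerivWithin_one _ (hΩ.uniqueDiffOn x hx), fderivWithin_of_isOpen hΩ hx,
    add_comm 1 i] at h
  simpa [mul_assoc] using h

theorem norm_extCoeff_le (j : ℕ) {x : E × ℝ} (hx : x ∈ Ω) :
    ‖extCoeff L b F j x‖ ≤
      (A + |b|) * ((2 * (A + |b|) * B) ^ j * ((j + 1).factorial : ℝ) ^ 3) := by
  have h := norm_iteratedFDerivWithin_extCoeff_le hA hB (by positivity) hΩ hF hx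
    (norm_iteratedFDerivWithin_jointCoeff_le (b := b) hA hB hL hΩ hF hb j 0 hx)
  rw [norm_iteratedFDerivWithin_zero, zero_add, pow_zero, mul_one, mul_assoc] at h
  refine h.trans ?_
  gcongr
  omega

theorem norm_fderiv_jointField_le {ε : ℝ} (hε : 0 ≤ ε) {n : ℕ}
    (hn : n = 0 ∨ ε * (2 * (A + |b|) * B) * (n + 1) ^ 3 ≤ Real.exp (-3)) {x : E × ℝ}
    (hx : x ∈ Ω) : ‖fderiv ℝ (jointField L b F ε n) x‖ ≤ ε * (2 * A * B) := by
  set M : ℝ := 2 * (A + |b|) * B with hM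
  have hM0 : 0 ≤ M := by positivity
  rw [(hasFDerivAt_jointField hΩ hF ε n hx).fderiv, norm_smul, Real.norm_of_nonneg hε]
  gcongr
  calc _ ≤ ∑ i ∈ range (n + 1), A * B * (ε * M * (n + 1) ^ 3) ^ i := by
        refine norm_sum_le_of_le _ fun i hi => ?_
        have hi' : i ≤ n := Nat.lt_succ_iff.1 (Finset.mem_range.1 hi)
        rw [norm_smul, norm_pow, Real.norm_of_nonneg hε]
        calc _ ≤ ε ^ i * (A * B * (M ^ i * ((i + 1).factorial : ℝ) ^ 3)) := by
              gcongr
              exact norm_fderiv_jointCoeff_le hA hB hL hΩ hF hb i hx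
          _ = A * B * (ε ^ i * (M ^ i * ((i + 1).factorial : ℝ) ^ 3)) := by ring
          _ ≤ _ := by
              gcongr
              exact mul_pow_factorial_succ_cube_le hε hM0 hi'
    _ ≤ A * B * 2 := by
        rw [← Finset.mul_sum]
        gcongr
        exact sum_pow_le_two (by positivity) hn
    _ = _ := by ring

theorem norm_residual_le {ε : ℝ} (hε : 0 ≤ ε) {n : ℕ}
    (hn : n = 0 ∨ ε * (2 * (A + |b|) * B) * (n + 1) ^ 3 ≤ Real.exp (-3)) {x : E × ℝ}
    (hx : x ∈ Ω) :
    ‖∑ p ∈ range (n + 1) ×ˢ range (n + 1) with n ≤ p.1 + p.2,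
        ε ^ (p.1 + p.2 + 2) • fderiv ℝ (jointCoeff L b F p.1) x (extCoeff L b F p.2 x)‖ ≤
      ε ^ 2 * (A * B * (A + |b|)) * Real.exp (-n) := by
  set M : ℝ := 2 * (A + |b|) * B with hM
  have hM0 : 0 ≤ M := by positivity
  set y : ℝ := ε * M * (n + 1) ^ 3 with hy
  have hy0 : 0 ≤ y := by positivity
  -- For n = 0 the ratio `y` may exceed 1, but the upper bound then forces k = 0.
  have hpow : ∀ k, n ≤ k → k ≤ n + n → y ^ k ≤ y ^ n := by
    intro k hk hk'
    rcases hn with rfl | hn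
    · rw [show k = 0 by omega]
    · refine pow_le_pow_of_le_one hy0 (hn.trans ?_) hk
      exact Real.exp_le_one_iff.2 (by norm_num)
  have hterm : ∀ p ∈ (range (n + 1) ×ˢ range (n + 1)).filter (fun p : ℕ × ℕ => n ≤ p.1 + p.2),
      ‖ε ^ (p.1 + p.2 + 2) • fderiv ℝ (jointCoeff L b F p.1) x (extCoeff L b F p.2 x)‖ ≤
        ε ^ 2 * (A * B * (A + |b|)) * y ^ n := by
    rintro ⟨i, j⟩ hp
    simp only [Finset.mem_filter, Finset.mem_product, Finset.mem_range] at hp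
    have hi : i ≤ n := by omega
    have hj : j ≤ n := by omega
    rw [norm_smul, norm_pow, Real.norm_of_nonneg hε]
    calc _ ≤ ε ^ (i + j + 2) * ((A * B * (M ^ i * ((i + 1).factorial : ℝ) ^ 3)) *
          ((A + |b|) * (M ^ j * ((j + 1).factorial : ℝ) ^ 3))) := by
          gcongr
          exact ContinuousLinearMap.le_of_opNorm_le_of_le _
            (norm_fderiv_jointCoeff_le hA hB hL hΩ hF hb i hx)
            (norm_extCoeff_le hA hB hL hΩ hF hb j hx)
      _ = ε ^ 2 * (A * B * (A + |b|)) * ((ε ^ i * (M ^ i * ((i + 1).factorial : ℝ) ^ 3)) *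
          (ε ^ j * (M ^ j * ((j + 1).factorial : ℝ) ^ 3))) := by ring
      _ ≤ ε ^ 2 * (A * B * (A + |b|)) * (y ^ i * y ^ j) := by
          gcongr
          · exact mul_pow_factorial_succ_cube_le hε hM0 hi
          · exact mul_pow_factorial_succ_cube_le hε hM0 hj
      _ ≤ _ := by
          rw [← pow_add]
          exact mul_le_mul_of_nonneg_left (hpow _ hp.2 (by omega)) (by positivity)
  calc _ ≤ ∑ p ∈ range (n + 1) ×ˢ range (n + 1) with n ≤ p.1 + p.2,
        ε ^ 2 * (A * B * (A + |b|)) * y ^ n := norm_sum_le_of_le _ hterm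
    _ ≤ ∑ p ∈ range (n + 1) ×ˢ range (n + 1), ε ^ 2 * (A * B * (A + |b|)) * y ^ n :=
        Finset.sum_le_sum_of_subset_of_nonneg (Finset.filter_subset _ _)
          fun _ _ _ => by positivity
    _ = ε ^ 2 * (A * B * (A + |b|)) * (((n : ℝ) + 1) ^ 2 * y ^ n) := by
        simp only [Finset.sum_const, card_product, card_range, nsmul_eq_mul]
        push_cast
        ring
    _ ≤ _ := by
        gcongr
        exact sq_mul_pow_le_exp hy0 hn

end Bounds

end OptimalBalance

namespace OptimalBalance

open Set Filter Topology

/-! ### An energy estimate for linear equations with a skew principal part -/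

/-- In the derivative of ‖w‖² the skew term drops out. Young's inequality with weight η turns the
forcing into η‖w‖² + δ²/η, and Gronwall applies. The weight is free so that it can later be matched
to the time scale. -/
theorem norm_sq_le_of_hasDerivWithinAt_skew {E : Type*} [NormedAddCommGroup E]
    [InnerProductSpace ℝ E] {J' : E →L[ℝ] E} (hJ : ∀ v, inner ℝ v (J' v) = 0)
    {w r : ℝ → E} {A : ℝ → E →L[ℝ] E} {T κ δ η : ℝ} (hT : 0 ≤ T) (hκ : 0 ≤ κ) (hη : 0 < η)
    (hw : ∀ t ∈ Icc 0 T, HasDerivWithinAt w (J' (w t) - A t (w t) - r t) (Icc 0 T) t)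
    (hA : ∀ t ∈ Icc 0 T, ‖A t‖ ≤ κ) (hr : ∀ t ∈ Icc 0 T, ‖r t‖ ≤ δ) (h0 : w 0 = 0) :
    ‖w T‖ ^ 2 ≤ (δ / η) ^ 2 * Real.exp ((2 * κ + η) * T) := by
  have hd : ∀ t ∈ Icc 0 T, HasDerivWithinAt (fun t => ‖w t‖ ^ 2)
      (2 * inner ℝ (w t) (J' (w t) - A t (w t) - r t)) (Icc 0 T) t := fun t ht => (hw t ht).norm_sq
  have hK : 0 < 2 * κ + η := by positivity
  have hbound : ∀ t ∈ Icc 0 T, ‖2 * inner ℝ (w t) (J' (w t) - A t (w t) - r t)‖ ≤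
      (2 * κ + η) * ‖‖w t‖ ^ 2‖ + δ ^ 2 / η := by
    intro t ht
    rw [inner_sub_right, inner_sub_right, hJ, norm_mul, Real.norm_ofNat,
      Real.norm_of_nonneg (sq_nonneg ‖w t‖)]
    have h1 : |inner ℝ (w t) (A t (w t))| ≤ ‖w t‖ * (κ * ‖w t‖) :=
      (abs_real_inner_le_norm _ _).trans (by
        gcongr; exact (A t).le_of_opNorm_le (hA t ht) _)
    have h2 : |inner ℝ (w t) (r t)| ≤ ‖w t‖ * δ :=
      (abs_real_inner_le_norm _ _).trans (by gcongr; exact hr t ht)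
    have h3 : ‖0 - inner ℝ (w t) (A t (w t)) - inner ℝ (w t) (r t)‖ ≤
        ‖w t‖ * (κ * ‖w t‖) + ‖w t‖ * δ := by
      rw [zero_sub, Real.norm_eq_abs]
      refine (abs_sub _ _).trans ?_
      rw [abs_neg]
      exact add_le_add h1 h2
    have h4 : 2 * (‖w t‖ * δ) ≤ η * ‖w t‖ ^ 2 + δ ^ 2 / η := by
      have : η * ‖w t‖ ^ 2 + δ ^ 2 / η - 2 * (‖w t‖ * δ) = (η * ‖w t‖ - δ) ^ 2 / η := by
        field_simp; ring
      have h5 : 0 ≤ (η * ‖w t‖ - δ) ^ 2 / η := by positivity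
      linarith
    linarith
  have hg := norm_le_gronwallBound_of_norm_deriv_right_le (f := fun t => ‖w t‖ ^ 2) (δ := 0)
    (fun t ht => (hd t ht).continuousWithinAt)
    (fun t ht => (hd t (Ico_subset_Icc_self ht)).mono_of_mem_nhdsWithin
      (Icc_mem_nhdsGE_of_mem ht))
    (by simp [h0]) (fun t ht => hbound t (Ico_subset_Icc_self ht)) T (right_mem_Icc.2 hT)
  rw [Real.norm_of_nonneg (sq_nonneg _), gronwallBound_of_K_ne_0 hK.ne'] at hg
  simp only [zero_mul, zero_add, sub_zero] at hg
  refine hg.trans ?_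
  have h1 : δ ^ 2 / η / (2 * κ + η) ≤ (δ / η) ^ 2 := by
    rw [div_pow, div_div, sq η]
    gcongr
    linarith
  calc _ ≤ (δ / η) ^ 2 * (Real.exp ((2 * κ + η) * T) - 1) := by
        refine mul_le_mul_of_nonneg_right h1 ?_
        linarith [Real.one_le_exp (show 0 ≤ (2 * κ + η) * T by positivity)]
    _ ≤ _ := by
        gcongr
        linarith

/-! ### The canonical symplectic matrix -/

theorem J_apply_inl {d : ℕ} (v : Pos d) (i : Fin d) : J d v (Sum.inl i) = -v (Sum.inr i) := by
  simp [J, Matrix.J, Matrix.ofLp_toEuclideanCLM, Matrix.mulVec, dotProduct, Matrix.one_apply]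

theorem J_apply_inr {d : ℕ} (v : Pos d) (i : Fin d) : J d v (Sum.inr i) = v (Sum.inl i) := by
  simp [J, Matrix.J, Matrix.ofLp_toEuclideanCLM, Matrix.mulVec, dotProduct, Matrix.one_apply]

theorem J_neg_J_apply {d : ℕ} (v : Pos d) : J d ((-J d) v) = v := by
  ext (i | i)
  · rw [J_apply_inl]; simp [J_apply_inr]
  · rw [J_apply_inr]; simp [J_apply_inl]

theorem inner_J_self {d : ℕ} (v : Pos d) : inner ℝ v (J d v) = 0 := by
  simp only [PiLp.inner_apply, Fintype.sum_sum_type, J_apply_inl, J_apply_inr,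
    ← Finset.sum_add_distrib]
  refine Finset.sum_eq_zero fun i _ => ?_
  simp [mul_comm]

theorem norm_neg_J_le (d : ℕ) : ‖-J d‖ ≤ 1 := by
  refine ContinuousLinearMap.opNorm_le_bound _ zero_le_one fun v => ?_
  rw [one_mul, neg_apply, norm_neg, EuclideanSpace.norm_eq,
    EuclideanSpace.norm_eq]
  simp only [Fintype.sum_sum_type, J_apply_inl, J_apply_inr, norm_neg]
  rw [add_comm]

/-! ### The order of truncation -/

/-- With x = (εκ)^(-1/3), take n = ⌊x⌋ - 1, truncated at 0. Either n = 0 or n + 1 ≤ x, and always n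
> x - 2, whence the factor e². -/
theorem truncation_order_spec {κ ε : ℝ} (hκ : 0 < κ) (hε : 0 < ε) :
    ∃ n : ℕ, (n = 0 ∨ ε * κ * ((n : ℝ) + 1) ^ 3 ≤ 1) ∧
      Real.exp (-n) ≤ Real.exp 2 * Real.exp (-κ ^ (-(1 / 3 : ℝ)) * ε ^ (-(1 / 3 : ℝ))) := by
  set x : ℝ := (ε * κ) ^ (-(1 / 3 : ℝ)) with hx
  have hx0 : 0 < x := by positivity
  have hx3 : ε * κ * x ^ 3 = 1 := by
    rw [hx, ← Real.rpow_natCast, ← Real.rpow_mul (by positivity)]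
    norm_num
    rw [Real.rpow_neg_one]
    field_simp
  refine ⟨⌊x⌋₊ - 1, ?_, ?_⟩
  · rcases Nat.lt_or_ge ⌊x⌋₊ 1 with h | h
    · left; omega
    · right
      refine le_of_le_of_eq ?_ hx3
      gcongr
      have : ((⌊x⌋₊ - 1 : ℕ) : ℝ) + 1 = ⌊x⌋₊ := by
        rw [Nat.cast_sub h]; push_cast; ring
      rw [this]
      exact Nat.floor_le hx0.le
  · have h1 : (⌊x⌋₊ : ℝ) ≤ ((⌊x⌋₊ - 1 : ℕ) : ℝ) + 1 := by
      exact_mod_cast (by omega : ⌊x⌋₊ ≤ ⌊x⌋₊ - 1 + 1)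
    have h2 := Nat.lt_floor_add_one x
    have h3 : κ ^ (-(1 / 3 : ℝ)) * ε ^ (-(1 / 3 : ℝ)) = x := by
      rw [hx, Real.mul_rpow hε.le hκ.le, mul_comm]
    rw [← Real.exp_add, neg_mul, h3]
    exact Real.exp_le_exp.2 (by linarith)

end OptimalBalance

namespace OptimalBalance

open Set Filter Topology

/-! ### The ramped system: forcing, drift from the slow manifold, end values -/

theorem analyticOnNhd_gradient {d : ℕ} {V : Pos d → ℝ} {s : Set (Pos d)}
    (hV : AnalyticOnNhd ℝ V s) : AnalyticOnNhd ℝ (gradient V) s := by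
  -- The inverse Riesz map is conjugate-linear by type; over ℝ it is repackaged as linear, and
  -- finite dimension gives continuity.
  let T : StrongDual ℝ (Pos d) →ₗ[ℝ] Pos d :=
    { toFun := (InnerProductSpace.toDual ℝ (Pos d)).symm
      map_add' := fun x y => map_add _ x y
      map_smul' := fun c x => by simp }
  exact (LinearMap.toContinuousLinearMap T).comp_analyticOnNhd hV.fderiv

/-- The forcing term is jointly smooth and jointly of Gevrey class. -/
theorem exists_bounds_forcing {d : ℕ} {V : Pos d → ℝ} {z₀ : Pos d} {R : ℝ}
    (hV : AnalyticOnNhd ℝ V (Metric.closedBall z₀ R)) {σ : ℝ → ℝ} (hσ : ContDiff ℝ ∞ σ)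
    (bσ : ∃ A B : ℝ, 0 < A ∧ 0 < B ∧
      ∀ (n : ℕ) (x : ℝ), ‖iteratedFDeriv ℝ n σ x‖ ≤ A * B ^ n * (n.factorial : ℝ) ^ 2) :
    ContDiffOn ℝ ∞ (fun x : Pos d × ℝ => σ x.2 • (-J d) (gradient V x.1))
        (Metric.ball z₀ R ×ˢ univ) ∧
      ∃ A B : ℝ, 0 < A ∧ 0 < B ∧ ∀ (m : ℕ), ∀ x ∈ Metric.ball z₀ R ×ˢ (univ : Set ℝ),
        ‖iteratedFDerivWithin ℝ m (fun x : Pos d × ℝ => σ x.2 • (-J d) (gradient V x.1))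
          (Metric.ball z₀ R ×ˢ univ) x‖ ≤ A * B ^ m * (m.factorial : ℝ) ^ 3 := by
  have hg : AnalyticOnNhd ℝ (fun q => (-J d) (gradient V q)) (Metric.closedBall z₀ R) :=
    (-J d).comp_analyticOnNhd (analyticOnNhd_gradient hV)
  have hd : ContDiffOn ℝ ∞ (fun q => (-J d) (gradient V q)) (Metric.ball z₀ R) :=
    (hg.mono Metric.ball_subset_closedBall).contDiffOn Metric.isOpen_ball.uniqueDiffOn
  obtain ⟨A, B, hA, hB, h⟩ := bσ
  obtain ⟨A', B', hA', hB', h'⟩ :=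
    exists_norm_iteratedFDeriv_le_of_isCompact (isCompact_closedBall z₀ R) hg
  refine ⟨?_, A * A', B + B', by positivity, by positivity, fun m x hx => ?_⟩
  · exact (hσ.comp contDiff_snd).contDiffOn.smul (hd.comp contDiffOn_fst fun y hy => hy.1)
  · exact norm_iteratedFDerivWithin_smul_prod_le Metric.isOpen_ball hσ hd hA.le hB.le hA'.le
      hB'.le h (fun n q hq => h' q (Metric.ball_subset_closedBall hq) n) m hx

/-- Distance of a ramped trajectory from the slow manifold truncated at order `n`. -/
theorem norm_sub_jointField_le {d : ℕ} {V : Pos d → ℝ} {U : Set (Pos d)} (hU : IsOpen U)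
    {ρ σ : ℝ → ℝ} (hρσ : ∀ x ∈ Icc (0 : ℝ) 1, σ x = ρ x) (hσ0 : ∀ x ≤ 0, σ x = 0)
    {F : Pos d × ℝ → Pos d} (hFdef : F = fun x => σ x.2 • (-J d) (gradient V x.1))
    (hF : ContDiffOn ℝ ∞ F (U ×ˢ univ)) {A B : ℝ} (hA : 0 ≤ A) (hB : 0 ≤ B)
    (hb : ∀ m : ℕ, ∀ x ∈ U ×ˢ (univ : Set ℝ), ‖iteratedFDerivWithin ℝ m F (U ×ˢ univ) x‖ ≤
      A * B ^ m * (m.factorial : ℝ) ^ 3)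
    {a ε : ℝ} (ha : 0 < a) (hε : 0 < ε) {n : ℕ}
    (hn : n = 0 ∨ ε * (2 * (A + |a⁻¹|) * B) * (n + 1) ^ 3 ≤ Real.exp (-3))
    {qstar : Pos d} {q p : ℝ → Pos d} (hqp : IsRampSolution V ρ ε (a / ε) qstar q p)
    (hq : ∀ t ∈ Icc (0 : ℝ) (a / ε), q t ∈ U) :
    ‖p (a / ε) - jointField (-J d) a⁻¹ F ε n (qstar, 1)‖ ≤
      A * B * (A + |a⁻¹|) * ε * Real.exp (-n) * Real.exp ((4 * A * B + 1) * a / 2) := by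
  set T := a / ε with hTdef
  have hT : 0 < T := by positivity
  have hΩ : IsOpen (U ×ˢ (univ : Set ℝ)) := hU.prod isOpen_univ
  have hL := norm_neg_J_le d
  set S := jointField (-J d) a⁻¹ F ε n with hS
  set x : ℝ → Pos d × ℝ := fun t => (q t, t / T) with hx
  have hxΩ : ∀ t ∈ Icc 0 T, x t ∈ U ×ˢ (univ : Set ℝ) := fun t ht => ⟨hq t ht, mem_univ _⟩
  have hTb : 1 / T = ε * a⁻¹ := by rw [hTdef]; field_simp
  set r : ℝ → Pos d := fun t => fderiv ℝ S (x t) (S (x t), ε * a⁻¹) -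
      (J d (S (x t)) - ε • J d (F (x t))) with hr
  set D : ℝ → Pos d →L[ℝ] Pos d := fun t =>
    (fderiv ℝ S (x t)).comp (ContinuousLinearMap.inl ℝ (Pos d) ℝ) with hD
  have hder : ∀ t ∈ Icc 0 T, HasDerivWithinAt (fun t => p t - S (x t))
      (J d (p t - S (x t)) - D t (p t - S (x t)) - r t) (Icc 0 T) t := by
    intro t ht
    have h1 : HasDerivWithinAt x (p t, 1 / T) (Icc 0 T) t :=
      (hqp.deriv_q t ht).prodMk ((hasDerivWithinAt_id t _).div_const T)
    have h2 : HasFDerivAt S (fderiv ℝ S (x t)) (x t) :=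
      (hasFDerivAt_jointField hΩ hF ε n (hxΩ t ht)).differentiableAt.hasFDerivAt
    refine ((hqp.deriv_p t ht).sub (h2.comp_hasDerivWithinAt t h1)).congr_deriv ?_
    -- The actual velocity is the velocity on the graph plus the deviation: the first part yields
    -- the defect `r`, the second the linear term `D`.
    have h3 : ((p t, 1 / T) : Pos d × ℝ) =
        (S (x t), ε * a⁻¹) + ContinuousLinearMap.inl ℝ (Pos d) ℝ (p t - S (x t)) := by
      rw [hTb]; simp
    have h4 : ε • J d (F (x t)) = (ε * ρ (t / T)) • gradient V (q t) := by
      have : t / T ∈ Icc (0 : ℝ) 1 :=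
        ⟨div_nonneg ht.1 hT.le, div_le_one_of_le₀ ht.2 hT.le⟩
      rw [hFdef]
      simp only [hx, map_smul, J_neg_J_apply, hρσ _ this, smul_smul]
    rw [h3, map_add, hr, hD]
    simp only [h4, map_sub, ContinuousLinearMap.comp_apply]
    abel
  have hrb : ∀ t ∈ Icc 0 T, ‖r t‖ ≤ A * B * (A + |a⁻¹|) * ε * Real.exp (-n) * ε := by
    intro t ht
    simp only [hr]
    rw [hS, fderiv_jointField_residual hΩ hF J_neg_J_apply ε n (hxΩ t ht)]
    refine (norm_residual_le hA hB hL hΩ hF hb hε.le hn (hxΩ t ht)).trans_eq ?_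
    ring
  have hDb : ∀ t ∈ Icc 0 T, ‖D t‖ ≤ ε * (2 * A * B) := by
    intro t ht
    refine (ContinuousLinearMap.opNorm_comp_le _ _).trans ?_
    refine (mul_le_of_le_one_right (norm_nonneg _) (ContinuousLinearMap.norm_inl_le_one ..)).trans ?_
    exact norm_fderiv_jointField_le hA hB hL hΩ hF hb hε.le hn (hxΩ t ht)
  -- The forcing vanishes identically at negative slow times, so every coefficient vanishes at slow
  -- time 0.
  have h0 : p 0 - S (x 0) = 0 := by
    have hz : ∀ k, jointCoeff (-J d) a⁻¹ F k (x 0) = 0 := fun k => by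
      have hx0 : x 0 = (q 0, 0) := by simp [hx]
      rw [hx0]
      refine jointCoeff_eq_of_eq_on_closure hU isOpen_Iio hF (s := fun _ _ => 0) (I := Iio 0)
        ?_ (by simp) k (hq 0 ⟨le_rfl, hT.le⟩) (by simp)
      intro q _ t ht
      rw [hFdef]
      simp [hσ0 t (le_of_lt ht)]
    rw [hqp.initial, hS, jointField]
    simp [hz]
  -- The choice η = ε makes the growth exponent (4AB + 1)εT = (4AB + 1)a, free of ε.
  have key := norm_sq_le_of_hasDerivWithinAt_skew inner_J_self hT.le (by positivity) hε hder hDb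
    hrb h0
  have hxT : x T = (qstar, 1) := by simp [hx, hqp.final, hT.ne']
  simp only [hxT] at key
  refine (pow_le_pow_iff_left₀ (norm_nonneg _) (by positivity) two_ne_zero).1 (key.trans_eq ?_)
  rw [mul_pow _ (Real.exp _), ← Real.exp_nat_mul _ 2]
  congr 2
  · field_simp
  · rw [hTdef]; field_simp; push_cast; ring

/-- At the end of the ramp the formal slow vector field is that of the autonomous problem. -/
theorem jointField_eq_slowField {d : ℕ} {V : Pos d → ℝ} {U : Set (Pos d)} (hU : IsOpen U)
    {σ : ℝ → ℝ} (hσ1 : ∀ x, 1 ≤ x → σ x = 1) {F : Pos d × ℝ → Pos d}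
    (hFdef : F = fun x => σ x.2 • (-J d) (gradient V x.1))
    (hF : ContDiffOn ℝ ∞ F (U ×ˢ univ)) (b ε : ℝ) (n : ℕ) {q : Pos d} (hq : q ∈ U) :
    jointField (-J d) b F ε n (q, 1) = slowField V ε n q := by
  have hs : ∀ k, jointCoeff (-J d) b F k (q, 1) = slowCoeff V k q := fun k => by
    refine jointCoeff_eq_of_eq_on_closure hU isOpen_Ioi hF (I := Ioi 1) ?_
      (fun k q => slowCoeff_succ V k q) k hq (by simp)
    intro q _ t ht
    rw [hFdef, slowCoeff_zero]
    simp [hσ1 t (le_of_lt ht)]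
  simp only [jointField, slowField, hs]

end OptimalBalance

theorem theorem3 {d : ℕ} (ρ : ℝ → ℝ)
    (hρ_smooth : ContDiffOn ℝ ∞ ρ (Set.Icc 0 1))
    (hρ_gevrey : OptimalBalance.IsGevrey 2 ρ (Set.Ioo 0 1))
    (hρ_zero : ρ 0 = 0) (hρ_one : ρ 1 = 1)
    (hρ_order : ∀ i : ℕ, 1 ≤ i →
      iteratedDerivWithin i ρ (Set.Icc 0 1) 0 = 0 ∧
      iteratedDerivWithin i ρ (Set.Icc 0 1) 1 = 0)
    (a : ℝ) (ha : 0 < a)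
    (V : OptimalBalance.Pos d → ℝ) (z₀ : OptimalBalance.Pos d) (R : ℝ) (hR : 0 < R)
    (hV : AnalyticOnNhd ℝ V (Metric.closedBall z₀ R)) :
    ∃ (n : ℝ → ℕ) (c D : ℝ), 0 < c ∧ 0 < D ∧
      ∀ K : Set (OptimalBalance.Pos d), IsCompact K → K ⊆ Metric.closedBall z₀ (R / 2) →
      ∀ ε : ℝ, 0 < ε → ε ≤ 1 →
      ∀ (qstar : OptimalBalance.Pos d) (q p : ℝ → OptimalBalance.Pos d),
        OptimalBalance.IsRampSolution V ρ ε (a / ε) qstar q p →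
        (∀ t ∈ Set.Icc (0 : ℝ) (a / ε), q t ∈ K) →
        ‖p (a / ε) - OptimalBalance.slowField V ε (n ε) qstar‖
          ≤ D * Real.exp (-c * ε ^ (-(1 / 3 : ℝ))) := by
  open OptimalBalance in
  obtain ⟨σ, hσ, hρσ, hσ0, hσ1, bσ⟩ :=
    exists_flat_extension hρ_smooth hρ_gevrey hρ_zero hρ_one hρ_order
  obtain ⟨hF, A, B, hA, hB, hb⟩ := exists_bounds_forcing hV hσ bσ
  -- The factor e³ turns the threshold 1 of the truncation rule into the e^(-3) needed for the
  -- geometric bounds.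
  set κ : ℝ := Real.exp 3 * (2 * (A + |a⁻¹|) * B) with hκdef
  have hκ : 0 < κ := by positivity
  choose n hn hnexp using fun ε : Set.Ioi (0 : ℝ) => truncation_order_spec hκ ε.2
  classical
  -- The order for nonpositive ε is a dummy value.
  refine ⟨fun ε => if h : 0 < ε then n ⟨ε, h⟩ else 0, κ ^ (-(1 / 3 : ℝ)),
    A * B * (A + |a⁻¹|) * Real.exp 2 * Real.exp ((4 * A * B + 1) * a / 2), by positivity,
    by positivity, fun K _ hKR ε hε hε1 qstar q p hqp hqK => ?_⟩
  have hq : ∀ t ∈ Set.Icc (0 : ℝ) (a / ε), q t ∈ Metric.ball z₀ R := fun t ht =>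
    Metric.closedBall_subset_ball (by linarith) (hKR (hqK t ht))
  have hstar : qstar ∈ Metric.ball z₀ R := by
    rw [← hqp.final]; exact hq _ ⟨by positivity, le_rfl⟩
  simp only [dif_pos hε]
  set N := n ⟨ε, hε⟩ with hN
  have hNspec : N = 0 ∨ ε * (2 * (A + |a⁻¹|) * B) * ((N : ℝ) + 1) ^ 3 ≤ Real.exp (-3) := by
    refine (hn ⟨ε, hε⟩).imp id fun h => ?_
    rw [Real.exp_neg, inv_eq_one_div (Real.exp 3), le_div_iff₀ (Real.exp_pos 3)]
    refine le_of_eq_of_le ?_ h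
    rw [hκdef]; ring
  have h1 := norm_sub_jointField_le Metric.isOpen_ball hρσ hσ0 rfl hF hA.le hB.le hb ha hε
    hNspec hqp hq
  rw [jointField_eq_slowField Metric.isOpen_ball hσ1 rfl hF _ _ _ hstar] at h1
  refine h1.trans ?_
  calc _ ≤ A * B * (A + |a⁻¹|) * 1 * Real.exp (-N) * Real.exp ((4 * A * B + 1) * a / 2) := by
        gcongr
    _ = A * B * (A + |a⁻¹|) * Real.exp ((4 * A * B + 1) * a / 2) * Real.exp (-N) := by ring
    _ ≤ A * B * (A + |a⁻¹|) * Real.exp ((4 * A * B + 1) * a / 2) *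
        (Real.exp 2 * Real.exp (-κ ^ (-(1 / 3 : ℝ)) * ε ^ (-(1 / 3 : ℝ)))) := by
        gcongr
        exact hnexp ⟨ε, hε⟩
    _ = _ := by ring
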